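/- A partition is a non-increasing sequence $\lambda=(\lambda_1\ge\lambda_2\ge\cdots)$ of nonnegative integers with finitely many nonzero terms; $|\lambda|=\sum_i\lambda_i$, its conjugate $\lambda'$ is given by $\lambda'_j=\#\{i:\lambda_i\ge j\}$, and $m_k(\lambda)=\#\{j:\lambda_j=k\}$ for $k\ge 1$. Let $\mathcal P$ be the set of partitions, including the empty partition $\emptyset$, and let $\mathcal I(2)$ be the set of monic irreducible polynomials over $\mathbb F_2$. For a monic polynomial $f=X^d+a_{d-1}X^{d-1}+\dots+a_0$ let $M(f)$ be its companion matrix (the $d\times d$ matrix with ones on the superdiagonal, last row $(-a_0,\dots,-a_{d-1})$ and zeros elsewhere; $M(1)$ is the $0\times0$ matrix). For a function $\Lambda:\mathcal I(2)\to\mathcal P$ with $\Lambda(\phi)=\emptyset$ for all but finitely many $\phi$, put $\dim\Lambda=\sum_\phi|\Lambda(\phi)|\deg\phi$. If $\dim\Lambda=n$, the conjugacy class in $\mathrm{Mat}_n(\mathbb F_2)$ with data $\Lambda$ is the set of all matrices similar over $\mathbb F_2$ to $\bigoplus_{\phi}\bigoplus_i M\bigl(\phi^{\Lambda(\phi)_i}\bigr)$,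 and we say that $\Lambda$ describes its elements. Theorem. For $n\ge 0$ let $\mathcal C_n=\{B^2: B\in\mathrm{Mat}_n(\mathbb F_2)\}$ be the set of squares, and let $$\mathcal S=\{\lambda\in\mathcal P : m_{2i-1}(\lambda')\le 1 \text{ for all } i\ge 1\}\cup\{\emptyset\}.$$ Then every $\mathcal C_n$ is a union of conjugacy classes, and the sequence $(\mathcal C_n)$ is partition uniform with respect to $\mathcal S$; that is, for every $n$, the functions $\Lambda$ which describe elements of $\mathcal C_n$ are exactly those with $\dim\Lambda=n$ and $\Lambda(\phi)\in\mathcal S$ for all $\phi\in\mathcal I(2)$. In particular, if $\dim\Lambda=n$, then the class with data $\Lambda$ consists of squares if and only if $\Lambda(\phi)\in\mathcal S$ for every $\phi\in\mathcal I(2)$. -/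

import Mathlib

open Polynomial

noncomputable section

/-- The monic irreducible polynomials over a field `F`. -/
def MonicIrred (F : Type*) [Field F] : Type _ :=
  {φ : F[X] // φ.Monic ∧ Irreducible φ}

/-- The companion matrix of a (monic) polynomial `φ = a₀ + a₁ X + ⋯ + X ^ d`: it has ones just
above the diagonal, its last row is `-a₀, …, -a_{d-1}`, and its other entries are zero.
For `φ = 1` it is the `0 × 0` matrix. -/
def companionMatrix {F : Type*} [Field F] (φ : F[X]) :
    Matrix (Fin φ.natDegree) (Fin φ.natDegree) F :=
  Matrix.of fun i j =>
    if (i : ℕ) + 1 = φ.natDegree then - φ.coeff j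
    else if (j : ℕ) = i + 1 then 1
    else 0

/-- The multiplicity `m_k(λ)`, for `k ≥ 1`: the number of parts of the partition `λ` that are
equal to `k`. Partitions are represented by Young diagrams: the parts are the row lengths, the
conjugate partition is the transpose, the weight is the number of cells and the empty partition
is `⊥`. -/
def partMult (lam : YoungDiagram) (k : ℕ) : ℕ :=
  lam.rowLens.count k

/-- Data of a conjugacy class of square matrices over `F`: a function from the monic irreducible
polynomials to the partitions, with empty value at all but finitely many polynomials. -/
structure ClassData (F : Type*) [Field F] where
  /-- the partition attached to a polynomial -/
  toFun : MonicIrred F → YoungDiagram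
  finite_support : {φ | toFun φ ≠ ⊥}.Finite

namespace ClassData

variable {F : Type*} [Field F]

instance : CoeFun (ClassData F) (fun _ => MonicIrred F → YoungDiagram) := ⟨ClassData.toFun⟩

/-- The dimension `∑_φ |Λ(φ)| deg φ` (only finitely many terms are nonzero). -/
def dim (L : ClassData F) : ℕ :=
  ∑ᶠ φ : MonicIrred F, (L φ).card * φ.1.natDegree

/-- Indices of the rows and columns of the standard representative: a pair `(φ, i)` selects the
block `M(φ ^ Λ(φ)_i)`. The parts `Λ(φ)_i = 0` give `0 × 0` blocks, without indices, so that this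
is a finite type, with `dim Λ` elements. -/
abbrev RepIndex (L : ClassData F) : Type _ :=
  Σ p : MonicIrred F × ℕ, Fin (p.1.1 ^ (L p.1).rowLen p.2).natDegree

open Classical in
/-- The standard representative (rational canonical form) `⨁_φ ⨁_i M(φ ^ Λ(φ)_i)`. -/
def stdRep (L : ClassData F) : Matrix L.RepIndex L.RepIndex F :=
  Matrix.blockDiagonal' fun p : MonicIrred F × ℕ =>
    companionMatrix (p.1.1 ^ (L p.1).rowLen p.2)

/-- The conjugacy class in `Mat_n(F)` specified by `Λ`: all the matrices that are similar to the
standard representative, its rows and columns being numbered by `Fin n` in some order (the order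
does not matter up to similarity; there is no such numbering unless `dim Λ = n`). -/
def conjClass (L : ClassData F) (n : ℕ) : Set (Matrix (Fin n) (Fin n) F) :=
  {A | ∃ e : L.RepIndex ≃ Fin n, IsConj (Matrix.reindex e e L.stdRep) A}

end ClassData

/-- `C` is a union of conjugacy classes under invertible matrices. -/
def IsUnionOfConjClasses {F : Type*} [Field F] {n : ℕ} (C : Set (Matrix (Fin n) (Fin n) F)) :
    Prop :=
  ∃ T : Set (ConjClasses (Matrix (Fin n) (Fin n) F)), C = ⋃ c ∈ T, c.carrier

/-- The sequence `C n ⊆ Mat_n(F)` of unions of conjugacy classes is partition restricted with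
respect to the family `S φ` of sets of partitions containing the empty one: the data `Λ`
describing the elements of `C n` are exactly those with `dim Λ = n` and `Λ(φ) ∈ S φ` for
all `φ`. -/
def IsPartitionRestricted {F : Type*} [Field F] (C : ∀ n : ℕ, Set (Matrix (Fin n) (Fin n) F))
    (S : MonicIrred F → Set YoungDiagram) : Prop :=
  (∀ φ, ⊥ ∈ S φ) ∧
  (∀ n, IsUnionOfConjClasses (C n)) ∧
  ∀ (n : ℕ) (L : ClassData F),
    (∃ A ∈ C n, A ∈ L.conjClass n) ↔ (L.dim = n ∧ ∀ φ, L φ ∈ S φ)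

/-- Partition uniform: partition restricted with the same set `S` for all polynomials. -/
def IsPartitionUniform {F : Type*} [Field F] (C : ∀ n : ℕ, Set (Matrix (Fin n) (Fin n) F))
    (S : Set YoungDiagram) : Prop :=
  IsPartitionRestricted C fun _ => S

/-- The set of squares in `Mat_n(𝔽₂)`. -/
def squareMatrices (n : ℕ) : Set (Matrix (Fin n) (Fin n) (ZMod 2)) :=
  {A | ∃ B, A = B ^ 2}

/-- The partitions `λ` with `m_{2i-1}(λ') ≤ 1` for all `i ≥ 1`, and the empty partition. -/
def squarePartitions : Set YoungDiagram :=
  {lam | ∀ i : ℕ, 1 ≤ i → partMult lam.transpose (2 * i - 1) ≤ 1} ∪ {⊥}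

end

/-! Row vectors under a matrix of the class `L` form the `F[X]`-module `⨁ F[X]/(φ ^ λ_i)`, with `X`
acting as `shift`; so the question is when `shift` has a square root `T`. Necessity: Frobenius gives
`φ(T²) = φ(T)²`. With `S = φ(T)` and `r m = dim (ker S ∩ im S^m)`, the `m`-th column of `L φ` has
length `(r (2m) + r (2m+1)) / deg φ`. As `r` is antitone, two equal columns `j < k` force `r` to be
constant from `2j` to `2k+1`; since `deg φ ∣ r (2j)`, the common length is even
(`mem_squarePartitions_of_shift_eq_sq`). Sufficiency: the condition makes the rows `a = λ_{2i}`, `b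
= λ_{2i+1}` (numbered from 0) differ by at most 1. Then `(f, g) ↦ f² + φ g²` identifies `F[X]/(φ^a)
× F[X]/(φ^b)` with `F[X]/(φ^(a+b))`, turning `X` into `X²`, whose square root is multiplication by
`X` (`exists_sq_eq_prodMap_mulLeft_root`). -/

noncomputable section

/-! ### Row and column lengths of Young diagrams -/

namespace YoungDiagram

theorem lt_rowLen_iff_lt_colLen (lam : YoungDiagram) {i j : ℕ} :
    j < lam.rowLen i ↔ i < lam.colLen j := by
  rw [← mem_iff_lt_rowLen, mem_iff_lt_colLen]

theorem rowLen_eq_zero_iff (lam : YoungDiagram) {i : ℕ} :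
    lam.rowLen i = 0 ↔ lam.colLen 0 ≤ i := by
  rw [← not_lt, ← lt_rowLen_iff_lt_colLen, Nat.pos_iff_ne_zero, not_not]

theorem card_eq_sum_rowLen (lam : YoungDiagram) :
    lam.card = ∑ i ∈ Finset.range (lam.colLen 0), lam.rowLen i := by
  rw [YoungDiagram.card, Finset.card_eq_sum_card_fiberwise (f := Prod.fst)
    (t := Finset.range (lam.colLen 0))]
  · exact Finset.sum_congr rfl fun i _ => (lam.rowLen_eq_card).symm
  · rintro ⟨i, j⟩ h
    have h : (i, j) ∈ lam := h
    rw [mem_iff_lt_rowLen] at h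
    simpa using lam.lt_rowLen_iff_lt_colLen.1 (Nat.zero_lt_of_lt h)

/-- The sum of `min k λ_i` counts the cells in the first `k` columns. -/
theorem sum_min_succ_rowLen (lam : YoungDiagram) (k : ℕ) :
    ∑ i ∈ Finset.range (lam.colLen 0), min (k + 1) (lam.rowLen i) =
      ∑ i ∈ Finset.range (lam.colLen 0), min k (lam.rowLen i) + lam.colLen k := by
  have h : lam.colLen k = ∑ i ∈ Finset.range (lam.colLen 0), if k < lam.rowLen i then 1 else 0 := by
    rw [← Finset.card_filter]
    conv_lhs => rw [← Finset.card_range (lam.colLen k)]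
    congr 1
    ext i
    have := lam.colLen_anti 0 k (Nat.zero_le k)
    simp only [Finset.mem_range, Finset.mem_filter, lt_rowLen_iff_lt_colLen]
    omega
  rw [h, ← Finset.sum_add_distrib]
  refine Finset.sum_congr rfl fun i _ => ?_
  split_ifs <;> omega

end YoungDiagram

theorem partMult_transpose (lam : YoungDiagram) (k : ℕ) :
    partMult lam.transpose k =
      ((Finset.range (lam.rowLen 0)).filter fun j => lam.colLen j = k).card := by
  rw [partMult, YoungDiagram.rowLens, YoungDiagram.colLen_transpose, List.count, List.countP_map,
    List.countP_eq_length_filter, ← List.toFinset_card_of_nodup (List.nodup_range.filter _)]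
  congr 1
  ext j
  simp [YoungDiagram.rowLen_transpose]

theorem bot_mem_squarePartitions : (⊥ : YoungDiagram) ∈ squarePartitions := Or.inr rfl

theorem mem_squarePartitions_of_colLen {lam : YoungDiagram}
    (h : ∀ j k, j < k → lam.colLen j = lam.colLen k → ¬ Odd (lam.colLen j)) :
    lam ∈ squarePartitions := by
  refine Or.inl fun i hi => ?_
  rw [partMult_transpose, Finset.card_le_one]
  intro j hj k hk
  rw [Finset.mem_filter] at hj hk
  have hodd : Odd (2 * i - 1) := ⟨i - 1, by omega⟩
  rcases lt_trichotomy j k with hjk | hjk | hjk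
  · exact absurd (hj.2 ▸ hodd) (h j k hjk (hj.2.trans hk.2.symm))
  · exact hjk
  · exact absurd (hk.2 ▸ hodd) (h k j hjk (hk.2.trans hj.2.symm))

/-- A drop of at least 2 from row `2i` to row `2i+1` would leave two columns of the same odd length
`2i+1`. -/
theorem rowLen_le_of_mem_squarePartitions {lam : YoungDiagram} (h : lam ∈ squarePartitions)
    (i : ℕ) : lam.rowLen (2 * i) ≤ lam.rowLen (2 * i + 1) + 1 := by
  rcases h with h | rfl
  · by_contra! hlt
    have hcol : ∀ j, lam.rowLen (2 * i + 1) ≤ j → j < lam.rowLen (2 * i) →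
        lam.colLen j = 2 * i + 1 := by
      intro j h1 h2
      have h3 := lam.lt_rowLen_iff_lt_colLen.1 h2
      have h4 := mt lam.lt_rowLen_iff_lt_colLen.2 h1.not_gt
      omega
    have h0 := lam.rowLen_anti 0 (2 * i) (Nat.zero_le _)
    -- The index is `i + 1` because `2 * (i + 1) - 1 = 2 * i + 1`.
    have hc := h (i + 1) (by omega)
    rw [partMult_transpose, Finset.card_le_one] at hc
    have := hc (lam.rowLen (2 * i + 1))
      (Finset.mem_filter.2 ⟨Finset.mem_range.2 (by omega), hcol _ le_rfl (by omega)⟩)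
      (lam.rowLen (2 * i + 1) + 1)
      (Finset.mem_filter.2 ⟨Finset.mem_range.2 (by omega), hcol _ (by omega) (by omega)⟩)
    omega
  · have : (⊥ : YoungDiagram).rowLen (2 * i) = 0 := by
      by_contra hne
      exact YoungDiagram.notMem_bot _
        (YoungDiagram.mem_iff_lt_rowLen.2 (Nat.pos_of_ne_zero hne))
    omega

/-! ### Kernels of powers of an endomorphism -/

namespace LinearMap

variable {F V : Type*} [Field F] [AddCommGroup V] [Module F V]

/-- Rank-nullity for `S^k` restricted to `ker S^(k+1)`: the image is `ker S ∩ im S^k`, the kernel is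
`ker S^k`. -/
theorem finrank_ker_pow_succ [FiniteDimensional F V] (S : Module.End F V) (k : ℕ) :
    Module.finrank F (ker (S ^ (k + 1))) =
      Module.finrank F (ker (S ^ k)) + Module.finrank F ↥(ker S ⊓ range (S ^ k)) := by
  have hle : ker (S ^ k) ≤ ker (S ^ (k + 1)) := fun v hv => by
    rw [mem_ker] at hv ⊢
    rw [pow_succ', Module.End.mul_apply, hv, map_zero]
  have h := finrank_range_add_finrank_ker ((S ^ k).domRestrict (ker (S ^ (k + 1))))
  have h1 : range ((S ^ k).domRestrict (ker (S ^ (k + 1)))) = ker S ⊓ range (S ^ k) := by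
    ext v
    simp only [mem_range, Submodule.mem_inf, mem_ker, domRestrict_apply]
    constructor
    · rintro ⟨⟨w, hw⟩, rfl⟩
      refine ⟨?_, w, rfl⟩
      rwa [mem_ker, pow_succ', Module.End.mul_apply] at hw
    · rintro ⟨hv, w, rfl⟩
      refine ⟨⟨w, ?_⟩, rfl⟩
      rwa [mem_ker, pow_succ', Module.End.mul_apply]
  have h2 : Module.finrank F (ker ((S ^ k).domRestrict (ker (S ^ (k + 1))))) =
      Module.finrank F (ker (S ^ k)) := by
    rw [ker_domRestrict]
    exact (Submodule.comapSubtypeEquivOfLe hle).finrank_eq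
  rw [h1, h2] at h
  omega

theorem aeval_apply_of_intertwine {W : Type*} [AddCommGroup W] [Module F W] {S : Module.End F V}
    {T : Module.End F W} {g : V →ₗ[F] W} (h : ∀ v, g (S v) = T (g v)) (P : F[X]) (v : V) :
    g (aeval S P v) = aeval T P (g v) := by
  have hpow : ∀ n : ℕ, g ((S ^ n) v) = (T ^ n) (g v) := by
    intro n
    induction n with
    | zero => rfl
    | succ n ih => rw [pow_succ', pow_succ', Module.End.mul_apply, Module.End.mul_apply, h, ih]
  induction P using Polynomial.induction_on' with
  | add P Q hP hQ => rw [map_add, map_add, add_apply, add_apply, map_add, hP, hQ]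
  | monomial n a =>
    rw [aeval_monomial, aeval_monomial, Module.End.mul_apply, Module.End.mul_apply,
      Module.algebraMap_end_apply, Module.algebraMap_end_apply, map_smul, hpow]

/-- `V` becomes a vector space over the field `F[X]/(φ)`, and the tower law applies. -/
theorem natDegree_dvd_finrank_of_aeval_eq_zero {φ : F[X]} (hφ : Irreducible φ)
    (T : Module.End F V) (hT : aeval T φ = 0) : φ.natDegree ∣ Module.finrank F V := by
  have : Fact (Irreducible φ) := ⟨hφ⟩
  let f : AdjoinRoot φ →ₐ[F] Module.End F V :=
    Ideal.Quotient.liftₐ (Ideal.span {φ}) (aeval T) fun p hp => by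
      obtain ⟨q, rfl⟩ := Ideal.mem_span_singleton.1 hp
      rw [map_mul, hT, zero_mul]
  let : Module (AdjoinRoot φ) V := Module.compHom V f.toRingHom
  have : IsScalarTower F (AdjoinRoot φ) V := IsScalarTower.of_algebraMap_smul fun r v => by
    change f (algebraMap F _ r) v = r • v
    rw [AlgHom.commutes, Module.algebraMap_end_apply]
  rw [← Module.finrank_mul_finrank F (AdjoinRoot φ) V,
    (AdjoinRoot.powerBasis hφ.ne_zero).finrank, AdjoinRoot.powerBasis_dim]
  exact dvd_mul_right _ _

theorem natDegree_dvd_finrank_ker_inf_range {φ : F[X]} (hφ : Irreducible φ)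
    (T : Module.End F V) (k : ℕ) :
    φ.natDegree ∣ Module.finrank F ↥(ker (aeval T φ) ⊓ range (aeval T φ ^ k)) := by
  set N := ker (aeval T φ) ⊓ range (aeval T φ ^ k) with hN
  have hcomm : Commute T (aeval T φ) := by
    simpa using (Commute.all X φ).map (aeval T)
  have hinv : ∀ v ∈ N, T v ∈ N := by
    rintro v ⟨hv, w, rfl⟩
    refine ⟨?_, T w, ?_⟩
    · rw [SetLike.mem_coe, mem_ker] at hv ⊢
      rw [← Module.End.mul_apply, ← hcomm.eq, Module.End.mul_apply, hv, map_zero]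
    · rw [← Module.End.mul_apply, ← (hcomm.pow_right k).eq, Module.End.mul_apply]
  refine natDegree_dvd_finrank_of_aeval_eq_zero hφ (T.restrict hinv) ?_
  ext ⟨v, hv⟩
  have h : N.subtype (aeval (T.restrict hinv) φ ⟨v, hv⟩) = aeval T φ v :=
    aeval_apply_of_intertwine (S := T.restrict hinv) (T := T) (g := N.subtype) (fun _ => rfl) φ
      ⟨v, hv⟩
  exact h.trans hv.1

end LinearMap

/-! ### Direct sums with almost all summands zero -/

theorem finite_sigma_fin {ι : Type*} {c : ι → ℕ} {s : Finset ι} (h : ∀ i ∉ s, c i = 0) :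
    Finite (Σ i, Fin (c i)) := by
  refine Finite.of_surjective
    (fun x : Σ i : s, Fin (c i) => (⟨x.1, x.2⟩ : Σ i, Fin (c i))) ?_
  rintro ⟨i, x⟩
  have hi : i ∈ s := by
    by_contra hi
    exact (Fin.cast (h i hi) x).elim0
  exact ⟨⟨⟨i, hi⟩, x⟩, rfl⟩

theorem card_sigma_fin {ι : Type*} {c : ι → ℕ} {s : Finset ι} (h : ∀ i ∉ s, c i = 0) :
    Nat.card (Σ i, Fin (c i)) = ∑ i ∈ s, c i := by
  rw [← Finset.sum_coe_sort, ← Nat.card_congr (Equiv.ofBijective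
    (fun x : Σ i : s, Fin (c i) => (⟨x.1, x.2⟩ : Σ i, Fin (c i))) ⟨?_, ?_⟩), Nat.card_sigma]
  · simp
  · rintro ⟨⟨i, hi⟩, x⟩ ⟨⟨j, hj⟩, y⟩ hxy
    simp only [Sigma.mk.injEq] at hxy
    obtain ⟨rfl, hxy⟩ := hxy
    rw [eq_of_heq hxy]
  · rintro ⟨i, x⟩
    have hi : i ∈ s := by
      by_contra hi
      exact (Fin.cast (h i hi) x).elim0
    exact ⟨⟨⟨i, hi⟩, x⟩, rfl⟩

namespace LinearMap

variable {F U V W : Type*} [Field F] [AddCommGroup U] [Module F U] [AddCommGroup V] [Module F V]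
  [AddCommGroup W] [Module F W]

/-- Two linear maps with the same kernel have isomorphic ranges. -/
def equivRangeOfKerEq (P : U →ₗ[F] V) (Q : U →ₗ[F] W) (hP : Function.Surjective P)
    (h : ker P = ker Q) : V ≃ₗ[F] range Q :=
  (P.quotKerEquivOfSurjective hP).symm ≪≫ₗ Submodule.quotEquivOfEq _ _ h ≪≫ₗ Q.quotKerEquivRange

theorem equivRangeOfKerEq_apply (P : U →ₗ[F] V) (Q : U →ₗ[F] W) (hP : Function.Surjective P)
    (h : ker P = ker Q) (u : U) : (equivRangeOfKerEq P Q hP h (P u) : W) = Q u := by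
  have : (P.quotKerEquivOfSurjective hP).symm (P u) = Submodule.Quotient.mk u := by
    rw [LinearEquiv.symm_apply_eq]
    rfl
  simp [equivRangeOfKerEq, this]

end LinearMap

namespace DFinsupp

variable {ι F : Type*} [Field F] {M N : ι → Type*} [∀ i, AddCommGroup (M i)]
  [∀ i, Module F (M i)] [∀ i, AddCommGroup (N i)] [∀ i, Module F (N i)]

/-- The kernel of a componentwise linear map is the direct sum of the kernels. -/
theorem finrank_ker_mapRange (f : ∀ i, M i →ₗ[F] N i) [∀ i, FiniteDimensional F (M i)]
    {s : Finset ι} (h : ∀ i ∉ s, Module.finrank F (LinearMap.ker (f i)) = 0) :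
    Module.finrank F (LinearMap.ker (mapRange.linearMap f)) =
      ∑ i ∈ s, Module.finrank F (LinearMap.ker (f i)) := by
  let g := mapRange.linearMap fun i => (LinearMap.ker (f i)).subtype
  have hg : Function.Injective g := by
    rw [← LinearMap.ker_eq_bot, ker_mapRangeLinearMap, Submodule.eq_bot_iff]
    intro v hv
    ext i
    simpa using hv i trivial
  have hr : LinearMap.range g = LinearMap.ker (mapRange.linearMap f) := by
    rw [range_mapRangeLinearMap, ker_mapRangeLinearMap]
    simp
  rw [← hr, LinearMap.finrank_range_of_inj hg, Module.finrank_eq_nat_card_basis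
    (DFinsupp.basis fun i => Module.finBasis F (LinearMap.ker (f i))), card_sigma_fin h]

end DFinsupp

/-! ### Multiplication operators on `F[X] / (f)` -/

namespace AdjoinRoot

variable {F : Type*} [Field F]

theorem finiteDimensional_of_ne_zero {f : F[X]} (hf : f ≠ 0) :
    FiniteDimensional F (AdjoinRoot f) := (powerBasis hf).finite

theorem finrank_of_ne_zero {f : F[X]} (hf : f ≠ 0) :
    Module.finrank F (AdjoinRoot f) = f.natDegree := by
  rw [(powerBasis hf).finrank, powerBasis_dim]

theorem finrank_ker_mulLeft_of_isCoprime {f g : F[X]} (h : IsCoprime f g) :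
    Module.finrank F (LinearMap.ker (LinearMap.mulLeft F (mk f g))) = 0 := by
  suffices LinearMap.ker (LinearMap.mulLeft F (mk f g)) = ⊥ by rw [this, finrank_bot]
  rw [Submodule.eq_bot_iff]
  intro x hx
  obtain ⟨p, rfl⟩ := mk_surjective x
  rw [LinearMap.mem_ker, LinearMap.mulLeft_apply, ← map_mul, mk_eq_zero] at hx
  exact mk_eq_zero.2 (h.dvd_of_dvd_mul_left hx)

/-- For `k ≤ a` the kernel consists of the multiples of `φ^(a-k)`, a copy of `F[X]/(φ^k)`; for `a ≤
k` the operator vanishes. -/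
theorem finrank_ker_mulLeft_pow {φ : F[X]} (hφ : φ ≠ 0) (a k : ℕ) :
    Module.finrank F (LinearMap.ker (LinearMap.mulLeft F (mk (φ ^ a) (φ ^ k)))) =
      min k a * φ.natDegree := by
  have := finiteDimensional_of_ne_zero (pow_ne_zero a hφ)
  have h := LinearMap.finrank_range_add_finrank_ker (LinearMap.mulLeft F (mk (φ ^ a) (φ ^ k)))
  rcases le_total a k with hak | hak
  · have h0 : LinearMap.mulLeft F (mk (φ ^ a) (φ ^ k)) = 0 := by
      rw [mk_eq_zero.2 (pow_dvd_pow φ hak), LinearMap.mulLeft_zero_eq_zero]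
    rw [h0, LinearMap.ker_zero, finrank_top, finrank_of_ne_zero (pow_ne_zero a hφ),
      natDegree_pow, min_eq_right hak]
  · obtain ⟨b, rfl⟩ := Nat.exists_eq_add_of_le hak
    let L : F[X] →ₗ[F] AdjoinRoot (φ ^ (k + b)) :=
      (mkₐ (φ ^ (k + b))).toLinearMap.comp (LinearMap.mulLeft F (φ ^ b))
    have hL : ∀ p, L p = mk _ (φ ^ b * p) := fun p => rfl
    have hr : LinearMap.range L =
        LinearMap.ker (LinearMap.mulLeft F (mk (φ ^ (k + b)) (φ ^ k))) := by
      ext x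
      obtain ⟨p, rfl⟩ := mk_surjective x
      have hp : φ ^ (k + b) ∣ φ ^ k * p ↔ φ ^ b ∣ p := by
        rw [pow_add, mul_dvd_mul_iff_left (pow_ne_zero k hφ)]
      rw [LinearMap.mem_ker, LinearMap.mulLeft_apply, ← map_mul, mk_eq_zero, hp,
        LinearMap.mem_range]
      constructor
      · rintro ⟨q, hq⟩
        rw [hL, mk_eq_mk] at hq
        exact (dvd_sub_right (dvd_mul_right (φ ^ b) q)).1 ((pow_dvd_pow φ (Nat.le_add_left b k)).trans hq)
      · rintro ⟨q, rfl⟩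
        exact ⟨q, hL q⟩
    have hk : LinearMap.ker (mkₐ (φ ^ k)).toLinearMap = LinearMap.ker L := by
      ext p
      rw [LinearMap.mem_ker, LinearMap.mem_ker, hL, mk_eq_zero, add_comm, pow_add,
        mul_dvd_mul_iff_left (pow_ne_zero b hφ)]
      exact mk_eq_zero
    rw [← hr, ← (LinearMap.equivRangeOfKerEq _ L mk_surjective hk).finrank_eq,
      finrank_of_ne_zero (pow_ne_zero k hφ), natDegree_pow, min_eq_left hak]

end AdjoinRoot

theorem AdjoinRoot.aeval_mulLeft_root {F : Type*} [Field F] (f P : F[X]) :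
    aeval (LinearMap.mulLeft F (root f)) P = LinearMap.mulLeft F (mk f P) := by
  have h := aeval_algHom_apply (Algebra.lmul F (AdjoinRoot f)) (root f) P
  rwa [aeval_eq] at h

/-! ### The canonical module of a conjugacy class -/

namespace ClassData

variable {F : Type*} [Field F] (L : ClassData F)

theorem monic_block (p : MonicIrred F × ℕ) : (p.1.1 ^ (L p.1).rowLen p.2).Monic :=
  p.1.2.1.pow _

/-- The direct sum of the cyclic modules `F[X] / (φ ^ Λ(φ)_i)`. -/
abbrev CanonModule : Type _ :=
  Π₀ p : MonicIrred F × ℕ, AdjoinRoot (p.1.1 ^ (L p.1).rowLen p.2)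

/-- Multiplication by `X` on the direct sum of the modules `F[X] / (φ ^ Λ(φ)_i)`. -/
def shift : Module.End F L.CanonModule :=
  DFinsupp.mapRange.linearMap fun p =>
    LinearMap.mulLeft F (AdjoinRoot.root (p.1.1 ^ (L p.1).rowLen p.2))

/-- The basis of the canonical module formed by the powers of `X` in each summand. -/
def canonBasis : Module.Basis L.RepIndex F L.CanonModule :=
  DFinsupp.basis fun p => AdjoinRoot.powerBasisAux' (L.monic_block p)

open Classical in
theorem canonBasis_apply (p : MonicIrred F × ℕ)
    (k : Fin (p.1.1 ^ (L p.1).rowLen p.2).natDegree) :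
    L.canonBasis ⟨p, k⟩ = DFinsupp.single p (AdjoinRoot.root _ ^ (k : ℕ)) := by
  have h := (AdjoinRoot.powerBasis' (L.monic_block p)).basis_eq_pow k
  rw [← AdjoinRoot.powerBasis'_gen (L.monic_block p), ← h]
  apply L.canonBasis.repr.injective
  rw [Module.Basis.repr_self]
  ext ⟨q, l⟩
  change _ = (AdjoinRoot.powerBasisAux' (L.monic_block q)).repr 
    (DFinsupp.single (β := fun p : MonicIrred F × ℕ => AdjoinRoot (p.1.1 ^ (L p.1).rowLen p.2))
      p _ q) l
  by_cases hq : p = q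
  · subst hq
    rw [DFinsupp.single_eq_same]
    change _ = (AdjoinRoot.powerBasisAux' (L.monic_block p)).repr
      (AdjoinRoot.powerBasisAux' (L.monic_block p) k) l
    rw [Module.Basis.repr_self, Finsupp.single_apply, Finsupp.single_apply]
    simp
  · rw [DFinsupp.single_eq_of_ne (Ne.symm hq), map_zero, Finsupp.single_apply, if_neg]
    · rfl
    · intro h
      exact hq (congrArg Sigma.fst h)

open Classical in
theorem shift_single (p : MonicIrred F × ℕ) (x : AdjoinRoot (p.1.1 ^ (L p.1).rowLen p.2)) :
    L.shift (DFinsupp.single p x) = DFinsupp.single p (AdjoinRoot.root _ * x) := by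
  simp [shift]

/-- Multiplication by a polynomial `P` on the direct sum of the modules `F[X] / (φ ^ Λ(φ)_i)`. -/
def polyMul (P : F[X]) : Module.End F L.CanonModule :=
  DFinsupp.mapRange.linearMap fun p =>
    LinearMap.mulLeft F (AdjoinRoot.mk (p.1.1 ^ (L p.1).rowLen p.2) P)

theorem aeval_shift (P : F[X]) : aeval L.shift P = L.polyMul P := by
  classical
  refine DFinsupp.lhom_ext fun p x => ?_
  let g : AdjoinRoot (p.1.1 ^ (L p.1).rowLen p.2) →ₗ[F] L.CanonModule :=
    DFinsupp.lsingle (M := fun p : MonicIrred F × ℕ => AdjoinRoot (p.1.1 ^ (L p.1).rowLen p.2)) p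
  have hg : ∀ v, g (LinearMap.mulLeft F (AdjoinRoot.root _) v) = L.shift (g v) :=
    fun v => (L.shift_single p v).symm
  have h1 := LinearMap.aeval_apply_of_intertwine hg P x
  refine h1.symm.trans ?_
  rw [polyMul, DFinsupp.mapRange.linearMap_apply, DFinsupp.mapRange_single]
  exact congrArg (DFinsupp.single p) (LinearMap.congr_fun (AdjoinRoot.aeval_mulLeft_root _ P) x)

end ClassData

/-- Rows of the companion matrix hold the coordinates of `X * X^k`: the next power, or for the last
row the relation `f = 0`. This is why matrices act on row vectors throughout. -/
theorem AdjoinRoot.root_mul_root_pow_eq_sum {F : Type*} [Field F] {f : F[X]} (hf : f.Monic)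
    (k : Fin f.natDegree) :
    root f * root f ^ (k : ℕ) = ∑ l, companionMatrix f k l • root f ^ (l : ℕ) := by
  rw [← pow_succ']
  simp only [companionMatrix, Matrix.of_apply]
  split_ifs with h
  · have h0 := congrArg (mk f) hf.as_sum.symm
    rw [mk_self] at h0
    rw [map_add, map_pow, mk_X, map_sum, Finset.sum_range] at h0
    rw [h, eq_neg_of_add_eq_zero_left h0, ← Finset.sum_neg_distrib]
    refine Finset.sum_congr rfl fun l _ => ?_
    simp [Algebra.smul_def, algebraMap_eq]
  · rw [Finset.sum_eq_single (⟨k + 1, by omega⟩ : Fin f.natDegree)]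
    · simp
    · intro l _ hl
      rw [if_neg, zero_smul]
      intro h'
      exact hl (Fin.ext h')
    · simp

namespace ClassData

variable {F : Type*} [Field F] (L : ClassData F)

theorem shift_canonBasis [Fintype L.RepIndex] (x : L.RepIndex) :
    L.shift (L.canonBasis x) = ∑ y, L.stdRep x y • L.canonBasis y := by
  classical
  obtain ⟨p, k⟩ := x
  rw [canonBasis_apply, shift_single, AdjoinRoot.root_mul_root_pow_eq_sum (L.monic_block p)]
  have hinj : Function.Injective
      fun l : Fin (p.1.1 ^ (L p.1).rowLen p.2).natDegree => (⟨p, l⟩ : L.RepIndex) :=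
    fun _ _ h => eq_of_heq (Sigma.mk.inj h).2
  rw [← Finset.sum_subset (Finset.subset_univ (Finset.univ.map ⟨_, hinj⟩)), Finset.sum_map]
  · rw [← DFinsupp.lsingle_apply (R := F), map_sum]
    refine Finset.sum_congr rfl fun l _ => ?_
    rw [map_smul, DFinsupp.lsingle_apply]
    simp only [Function.Embedding.coeFn_mk]
    rw [canonBasis_apply, stdRep, Matrix.blockDiagonal'_apply_eq]
  · rintro ⟨q, l⟩ - h
    have hpq : p ≠ q := by
      rintro rfl
      exact h (Finset.mem_map.2 ⟨l, Finset.mem_univ _, rfl⟩)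
    rw [stdRep, Matrix.blockDiagonal'_apply_ne _ _ _ hpq, zero_smul]

/-- Row vectors, acted upon by a matrix of the class of `Λ`, form a copy of the canonical
module. -/
theorem exists_equiv_of_mem_conjClass {n : ℕ} {A : Matrix (Fin n) (Fin n) F}
    (hA : A ∈ L.conjClass n) :
    ∃ E : (Fin n → F) ≃ₗ[F] L.CanonModule, ∀ v, E (A.vecMulLinear v) = L.shift (E v) := by
  obtain ⟨e, c, hc⟩ := hA
  let _ : Fintype L.RepIndex := Fintype.ofEquiv _ e.symm
  let b := L.canonBasis.reindex e
  have hb : ∀ i, L.shift (b i) = ∑ j, Matrix.reindex e e L.stdRep i j • b j := by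
    intro i
    simp only [b, Module.Basis.reindex_apply, Matrix.reindex_apply, Matrix.submatrix_apply]
    rw [shift_canonBasis]
    exact (Equiv.sum_comp e.symm fun y => L.stdRep (e.symm i) y • L.canonBasis y).symm
  -- By this relation, `v ↦ v c` carries the row action of `A` to that of the standard
  -- representative.
  have hc : (c : Matrix (Fin n) (Fin n) F) * Matrix.reindex e e L.stdRep = A * c := hc
  have hbs : ∀ v : Fin n → F, L.shift (b.equivFun.symm v) =
      b.equivFun.symm (Matrix.vecMul v (Matrix.reindex e e L.stdRep)) := by
    intro v
    rw [Module.Basis.equivFun_symm_apply, Module.Basis.equivFun_symm_apply, map_sum]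
    simp only [map_smul, hb, Finset.smul_sum, Matrix.vecMul, dotProduct, Finset.sum_smul,
      smul_smul]
    exact Finset.sum_comm
  refine ⟨LinearEquiv.ofLinearMap (Matrix.vecMulLinear c.val) (Matrix.vecMulLinear c.inv) ?_ ?_ ≪≫ₗ
    b.equivFun.symm, fun v => ?_⟩
  · refine LinearMap.ext fun v => ?_
    simp [Matrix.vecMul_vecMul, -Matrix.coe_units_inv]
  · refine LinearMap.ext fun v => ?_
    simp [Matrix.vecMul_vecMul, -Matrix.coe_units_inv]
  · simp only [LinearEquiv.trans_apply, LinearEquiv.coe_ofLinearMap, Matrix.vecMulLinear_apply]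
    rw [hbs, Matrix.vecMul_vecMul, Matrix.vecMul_vecMul, hc]

end ClassData

/-! ### Dimension and kernel dimensions of the canonical module -/

namespace MonicIrred

variable {F : Type*} [Field F]

theorem ne_zero (φ : MonicIrred F) : φ.1 ≠ 0 := φ.2.1.ne_zero

theorem natDegree_pos (φ : MonicIrred F) : 0 < φ.1.natDegree := φ.2.2.natDegree_pos

theorem isCoprime_of_ne {φ ψ : MonicIrred F} (h : φ ≠ ψ) : IsCoprime φ.1 ψ.1 := by
  rw [φ.2.2.coprime_iff_not_dvd]
  intro hd
  exact h (Subtype.ext (eq_of_monic_of_associated φ.2.1 ψ.2.1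
    (φ.2.2.associated_of_dvd ψ.2.2 hd)))

end MonicIrred

namespace ClassData

variable {F : Type*} [Field F] (L : ClassData F)

open Classical in
/-- The pairs `(φ, i)` with `Λ(φ)_i ≠ 0`. -/
def indexSet : Finset (MonicIrred F × ℕ) :=
  L.finite_support.toFinset.biUnion fun φ => {φ} ×ˢ Finset.range ((L φ).colLen 0)

theorem mem_indexSet {p : MonicIrred F × ℕ} :
    p ∈ L.indexSet ↔ p.1 ∈ L.finite_support.toFinset ∧ p.2 ∈ Finset.range ((L p.1).colLen 0) := by
  obtain ⟨φ, i⟩ := p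
  simp [indexSet]

theorem rowLen_eq_zero_of_notMem {p : MonicIrred F × ℕ} (hp : p ∉ L.indexSet) :
    (L p.1).rowLen p.2 = 0 := by
  rw [mem_indexSet, not_and_or, Set.Finite.mem_toFinset, Set.mem_ofPred_eq, not_not,
    Finset.mem_range, not_lt] at hp
  rcases hp with hp | hp
  · by_contra hne
    rw [hp] at hne
    exact YoungDiagram.notMem_bot _ (YoungDiagram.mem_iff_lt_rowLen.2 (Nat.pos_of_ne_zero hne))
  · exact (YoungDiagram.rowLen_eq_zero_iff _).2 hp

theorem natDegree_block_eq_zero_of_notMem {p : MonicIrred F × ℕ} (hp : p ∉ L.indexSet) :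
    (p.1.1 ^ (L p.1).rowLen p.2).natDegree = 0 := by
  rw [L.rowLen_eq_zero_of_notMem hp, pow_zero, natDegree_one]

instance : Finite L.RepIndex :=
  finite_sigma_fin fun _ hp => L.natDegree_block_eq_zero_of_notMem hp

theorem card_repIndex : Nat.card L.RepIndex = L.dim := by
  rw [card_sigma_fin fun _ hp => L.natDegree_block_eq_zero_of_notMem hp,
    Finset.sum_finset_product _ L.finite_support.toFinset
      (fun φ => Finset.range ((L φ).colLen 0)) fun _ => L.mem_indexSet, dim,
    finsum_eq_sum_of_support_subset]
  · refine Finset.sum_congr rfl fun φ _ => ?_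
    rw [YoungDiagram.card_eq_sum_rowLen, Finset.sum_mul]
    exact Finset.sum_congr rfl fun i _ => natDegree_pow _ _
  · intro φ hφ
    rw [Set.Finite.coe_toFinset]
    intro h
    exact hφ (by simp [h])

instance : FiniteDimensional F L.CanonModule := Module.Finite.of_basis L.canonBasis

/-- On blocks of other irreducibles `φ` acts injectively by coprimality, so only the parts of `L φ`
contribute. -/
theorem finrank_ker_aeval_shift_pow (φ : MonicIrred F) (k : ℕ) :
    Module.finrank F (LinearMap.ker (aeval L.shift φ.1 ^ k)) =
      (∑ i ∈ Finset.range ((L φ).colLen 0), min k ((L φ).rowLen i)) * φ.1.natDegree := by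
  classical
  have hfd : ∀ p : MonicIrred F × ℕ,
      FiniteDimensional F (AdjoinRoot (p.1.1 ^ (L p.1).rowLen p.2)) := fun p =>
    AdjoinRoot.finiteDimensional_of_ne_zero (L.monic_block p).ne_zero
  rw [← map_pow, aeval_shift, polyMul,
    DFinsupp.finrank_ker_mapRange (s := {φ} ×ˢ Finset.range ((L φ).colLen 0)), Finset.sum_product,
    Finset.sum_singleton, Finset.sum_mul]
  · exact Finset.sum_congr rfl fun i _ =>
      AdjoinRoot.finrank_ker_mulLeft_pow φ.ne_zero ((L φ).rowLen i) k
  · rintro ⟨ψ, i⟩ h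
    by_cases hψ : ψ = φ
    · subst hψ
      refine (AdjoinRoot.finrank_ker_mulLeft_pow ψ.ne_zero ((L ψ).rowLen i) k).trans ?_
      rw [(YoungDiagram.rowLen_eq_zero_iff _).2, Nat.min_zero, zero_mul]
      simpa using h
    · exact AdjoinRoot.finrank_ker_mulLeft_of_isCoprime (MonicIrred.isCoprime_of_ne hψ).pow

theorem finrank_ker_aeval_shift_pow_succ (φ : MonicIrred F) (k : ℕ) :
    Module.finrank F (LinearMap.ker (aeval L.shift φ.1 ^ (k + 1))) =
      Module.finrank F (LinearMap.ker (aeval L.shift φ.1 ^ k)) +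
        (L φ).colLen k * φ.1.natDegree := by
  rw [finrank_ker_aeval_shift_pow, finrank_ker_aeval_shift_pow, YoungDiagram.sum_min_succ_rowLen,
    add_mul]

end ClassData

/-! ### Necessity of the column condition -/

theorem aeval_sq_zmod_two {A : Type*} [Ring A] [Algebra (ZMod 2) A] (a : A) (P : (ZMod 2)[X]) :
    aeval (a ^ 2) P = aeval a P ^ 2 := by
  rw [← expand_aeval, ZMod.expand_card, map_pow]

/-- If the canonical operator is a square, then the columns of odd length of the diagrams are
pairwise of distinct lengths. -/
theorem ClassData.mem_squarePartitions_of_shift_eq_sq (L : ClassData (ZMod 2))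
    {T : Module.End (ZMod 2) L.CanonModule} (hT : L.shift = T ^ 2) (φ : MonicIrred (ZMod 2)) :
    L φ ∈ squarePartitions := by
  refine mem_squarePartitions_of_colLen fun j k hjk heq hodd => ?_
  set S := aeval T φ.1 with hS
  let r : ℕ → ℕ := fun m => Module.finrank (ZMod 2) ↥(LinearMap.ker S ⊓ LinearMap.range (S ^ m))
  have hSS : aeval L.shift φ.1 = S ^ 2 := by
    rw [hT]
    exact aeval_sq_zmod_two T φ.1
  -- One power of `φ(shift) = S²` amounts to two steps in the kernels of powers of `S`.
  have hr : ∀ m, (L φ).colLen m * φ.1.natDegree = r (2 * m) + r (2 * m + 1) := by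
    intro m
    have h := L.finrank_ker_aeval_shift_pow_succ φ m
    rw [hSS, ← pow_mul, ← pow_mul, mul_add, mul_one,
      LinearMap.finrank_ker_pow_succ S (2 * m + 1), LinearMap.finrank_ker_pow_succ S (2 * m)] at h
    change _ + r (2 * m) + r (2 * m + 1) = _ at h
    omega
  have hanti : Antitone r := antitone_nat_of_succ_le fun m => by
    refine Submodule.finrank_mono (inf_le_inf_left _ ?_)
    rw [pow_succ]
    exact LinearMap.range_comp_le_range _ _
  obtain ⟨d, hd⟩ := LinearMap.natDegree_dvd_finrank_ker_inf_range φ.2.2 T (2 * j)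
  change r (2 * j) = _ at hd
  have h1 := hr j
  have h2 := hr k
  rw [← heq] at h2
  -- Equal sums along a decreasing chain make all four values of `r` equal, so the column length is
  -- `2 * d`.
  have a1 := hanti (show 2 * j ≤ 2 * j + 1 by omega)
  have a2 := hanti (show 2 * j + 1 ≤ 2 * k by omega)
  have a3 := hanti (show 2 * k ≤ 2 * k + 1 by omega)
  have h3 : (L φ).colLen j * φ.1.natDegree = (2 * d) * φ.1.natDegree := by
    have : (2 * d) * φ.1.natDegree = 2 * (φ.1.natDegree * d) := by ring
    omega
  have h4 := Nat.eq_of_mul_eq_mul_right φ.natDegree_pos h3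
  rw [h4, Nat.odd_iff] at hodd
  omega

/-! ### Sufficiency: square roots on pairs of blocks -/

/-- The `φ`-adic orders of `f²` and `φ g²` have different parities, so no cancellation occurs. The
induction strips factors `φ` alternately from `f` and `g`. -/
theorem Irreducible.pow_dvd_sq_add_mul_sq_iff {F : Type*} [Field F] {φ : F[X]}
    (hφ : Irreducible φ) {a b : ℕ} (hba : b ≤ a) (hab : a ≤ b + 1) (f g : F[X]) :
    φ ^ (a + b) ∣ f ^ 2 + φ * g ^ 2 ↔ φ ^ a ∣ f ∧ φ ^ b ∣ g := by
  have hp := hφ.prime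
  constructor
  · suffices H : ∀ k, ∀ f g : F[X], φ ^ k ∣ f ^ 2 + φ * g ^ 2 →
        φ ^ ((k + 1) / 2) ∣ f ∧ φ ^ (k / 2) ∣ g by
      intro h
      have := H _ f g h
      rwa [show (a + b + 1) / 2 = a by omega, show (a + b) / 2 = b by omega] at this
    intro k
    induction k using Nat.strong_induction_on with
    | _ k ih =>
      intro f g h
      rcases k with _ | _ | k
      · simp
      · rw [zero_add, pow_one] at h
        have h1 : φ ∣ f := hp.dvd_of_dvd_pow ((dvd_add_left (dvd_mul_right φ _)).1 h)
        simpa using h1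
      · have h0 : φ ∣ f ^ 2 + φ * g ^ 2 := (dvd_pow_self φ (by omega)).trans h
        obtain ⟨f, rfl⟩ := hp.dvd_of_dvd_pow ((dvd_add_left (dvd_mul_right φ _)).1 h0)
        have e1 : (φ * f) ^ 2 + φ * g ^ 2 = φ * (φ * f ^ 2 + g ^ 2) := by ring
        rw [e1, pow_succ', mul_dvd_mul_iff_left hp.ne_zero] at h
        have h0 : φ ∣ φ * f ^ 2 + g ^ 2 := (dvd_pow_self φ (by omega)).trans h
        obtain ⟨g, rfl⟩ := hp.dvd_of_dvd_pow ((dvd_add_right (dvd_mul_right φ _)).1 h0)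
        have e2 : φ * f ^ 2 + (φ * g) ^ 2 = φ * (f ^ 2 + φ * g ^ 2) := by ring
        rw [e2, pow_succ', mul_dvd_mul_iff_left hp.ne_zero] at h
        have := ih k (by omega) f g h
        rw [show (k + 1 + 1 + 1) / 2 = (k + 1) / 2 + 1 by omega,
          show (k + 1 + 1) / 2 = k / 2 + 1 by omega, pow_succ', pow_succ']
        exact ⟨mul_dvd_mul_left _ this.1, mul_dvd_mul_left _ this.2⟩
  · rintro ⟨⟨f, rfl⟩, ⟨g, rfl⟩⟩
    refine dvd_add ?_ ?_
    · rw [mul_pow, ← pow_mul]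
      exact (pow_dvd_pow φ (by omega)).mul_right _
    · rw [mul_pow, ← mul_assoc, ← pow_mul, ← pow_succ']
      exact (pow_dvd_pow φ (by omega)).mul_right _

/-- Over `𝔽₂`, multiplication by `X` on `F[X] / (φ ^ a) × F[X] / (φ ^ b)` is a square if
`b ≤ a ≤ b + 1`: the product is isomorphic to `F[X] / (φ ^ (a + b))` with `X` acting as `X ^ 2`. -/
theorem AdjoinRoot.exists_sq_eq_prodMap_mulLeft_root {φ : (ZMod 2)[X]} (hφ : Irreducible φ)
    {a b : ℕ} (hba : b ≤ a) (hab : a ≤ b + 1) :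
    ∃ t : Module.End (ZMod 2) (AdjoinRoot (φ ^ a) × AdjoinRoot (φ ^ b)),
      ∀ x, t (t x) = (root _ * x.1, root _ * x.2) := by
  -- Squaring over `𝔽₂` is the substitution `X ↦ X²`, hence linear.
  let sq : (ZMod 2)[X] →ₗ[ZMod 2] (ZMod 2)[X] := (expand (ZMod 2) 2).toLinearMap
  have hsq : ∀ f, sq f = f ^ 2 := ZMod.expand_card
  let P := (mkₐ (φ ^ a)).toLinearMap.prodMap (mkₐ (φ ^ b)).toLinearMap
  let Q : (ZMod 2)[X] × (ZMod 2)[X] →ₗ[ZMod 2] AdjoinRoot (φ ^ (a + b)) :=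
    (mkₐ (φ ^ (a + b))).toLinearMap.comp
      (sq.coprod ((LinearMap.mulLeft (ZMod 2) φ).comp sq))
  have hQ : ∀ f g, Q (f, g) = mk _ (f ^ 2 + φ * g ^ 2) := fun f g => by
    simp [Q, hsq]
  have hP : ∀ f g, P (f, g) = (mk _ f, mk _ g) := fun f g => rfl
  have hPs : Function.Surjective P := Prod.map_surjective.2 ⟨mk_surjective, mk_surjective⟩
  have hker : LinearMap.ker P = LinearMap.ker Q := by
    ext ⟨f, g⟩
    rw [LinearMap.mem_ker, LinearMap.mem_ker, hQ, hP, Prod.mk_eq_zero, mk_eq_zero, mk_eq_zero,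
      mk_eq_zero, hφ.pow_dvd_sq_add_mul_sq_iff hba hab]
  have := finiteDimensional_of_ne_zero (pow_ne_zero a hφ.ne_zero)
  have := finiteDimensional_of_ne_zero (pow_ne_zero b hφ.ne_zero)
  have := finiteDimensional_of_ne_zero (pow_ne_zero (a + b) hφ.ne_zero)
  -- Both sides have dimension `(a + b) * deg φ`, so injectivity modulo `ker P` gives surjectivity.
  have htop : LinearMap.range Q = ⊤ := by
    apply Submodule.eq_top_of_finrank_eq
    rw [← (LinearMap.equivRangeOfKerEq P Q hPs hker).finrank_eq, Module.finrank_prod,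
      finrank_of_ne_zero (pow_ne_zero a hφ.ne_zero), finrank_of_ne_zero (pow_ne_zero b hφ.ne_zero),
      finrank_of_ne_zero (pow_ne_zero (a + b) hφ.ne_zero), natDegree_pow, natDegree_pow,
      natDegree_pow, add_mul]
  let e := LinearMap.equivRangeOfKerEq P Q hPs hker ≪≫ₗ LinearEquiv.ofTop _ htop
  have he : ∀ f g, e (mk _ f, mk _ g) = mk _ (f ^ 2 + φ * g ^ 2) := fun f g => by
    rw [← hQ]
    exact LinearMap.equivRangeOfKerEq_apply P Q hPs hker (f, g)
  refine ⟨e.symm.conj (LinearMap.mulLeft (ZMod 2) (root _)), fun x => ?_⟩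
  obtain ⟨⟨f, g⟩, rfl⟩ := hPs x
  apply e.injective
  rw [hP]
  simp only [← mk_X, ← map_mul, LinearEquiv.conj_apply_apply, LinearEquiv.apply_symm_apply,
    LinearEquiv.symm_symm, LinearMap.mulLeft_apply, he]
  congr 1
  ring

namespace DFinsupp

variable {ι F : Type*} [Field F] {A : ι × ℕ → Type*} [∀ p, AddCommGroup (A p)]
  [∀ p, Module F (A p)]

/-- Summands `2i` and `2i+1` are grouped, and the square roots on the pairs are assembled. Since all
`i : ℕ` occur, zero parts included, an odd number of nonzero rows needs no special care. -/
theorem exists_sq_eq_mapRange_of_pairs (f : ∀ p, Module.End F (A p))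
    (h : ∀ p : ι × ℕ, ∃ t : Module.End F (A (p.1, 2 * p.2) × A (p.1, 2 * p.2 + 1)),
      ∀ x, t (t x) = (f _ x.1, f _ x.2)) :
    ∃ T : Module.End F (Π₀ p, A p), mapRange.linearMap f = T ^ 2 := by
  classical
  choose t ht using h
  let V := Π₀ p : ι × ℕ, A (p.1, 2 * p.2) × A (p.1, 2 * p.2 + 1)
  let E : V →ₗ[F] Π₀ p, A p := lsum ℕ fun p =>
    (lsingle (M := A) (p.1, 2 * p.2)).coprod
      (lsingle (M := A) (p.1, 2 * p.2 + 1))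
  have hE : ∀ p x, E (single p x) =
      single (p.1, 2 * p.2) x.1 + single (p.1, 2 * p.2 + 1) x.2 := by
    intro p x
    exact lsum_single (M := fun p : ι × ℕ => A (p.1, 2 * p.2) × A (p.1, 2 * p.2 + 1)) ℕ _ p x
  have hsurj : Function.Surjective E := by
    rw [← LinearMap.range_eq_top, ← top_le_iff, ← iSup_range_lsingle (M := A)]
    refine iSup_le ?_
    rintro ⟨i, n⟩ _ ⟨x, rfl⟩
    obtain ⟨n, rfl | rfl⟩ := Nat.even_or_odd' n
    · exact ⟨single (i, n) (x, 0), by rw [hE]; simp⟩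
    · exact ⟨single (i, n) (0, x), by rw [hE]; simp⟩
  have hinj : Function.Injective E := by
    have h0 : ∀ p v, E v (p.1, 2 * p.2) = (v p).1 := by
      intro p v
      induction v using DFinsupp.induction with
      | h0 =>
        rw [map_zero]
        rfl
      | ha q x v _ _ ih =>
        rw [map_add, add_apply, add_apply, Prod.fst_add, ih, hE,
          add_apply, single_eq_of_ne (i := (q.1, 2 * q.2 + 1)), add_zero]
        · by_cases hpq : p = q
          · subst hpq
            simp
          · rw [single_eq_of_ne, single_eq_of_ne hpq]
            · rfl
            · intro h'
              rw [Prod.mk.injEq] at h'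
              exact hpq (Prod.ext h'.1 (by omega))
        · intro h'
          rw [Prod.mk.injEq] at h'
          omega
    have h1 : ∀ p v, E v (p.1, 2 * p.2 + 1) = (v p).2 := by
      intro p v
      induction v using DFinsupp.induction with
      | h0 =>
        rw [map_zero]
        rfl
      | ha q x v _ _ ih =>
        rw [map_add, add_apply, add_apply, Prod.snd_add, ih, hE,
          add_apply, single_eq_of_ne (i := (q.1, 2 * q.2)), zero_add]
        · by_cases hpq : p = q
          · subst hpq
            simp
          · rw [single_eq_of_ne, single_eq_of_ne hpq]
            · rfl
            · intro h'
              rw [Prod.mk.injEq] at h'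
              exact hpq (Prod.ext h'.1 (by omega))
        · intro h'
          rw [Prod.mk.injEq] at h'
          omega
    intro v w hvw
    ext p
    · exact (h0 p v).symm.trans ((DFunLike.congr_fun hvw _).trans (h0 p w))
    · exact (h1 p v).symm.trans ((DFunLike.congr_fun hvw _).trans (h1 p w))
  let e := LinearEquiv.ofBijective E ⟨hinj, hsurj⟩
  refine ⟨e.conj (mapRange.linearMap t), ?_⟩
  have hcomp : mapRange.linearMap f ∘ₗ E = E ∘ₗ mapRange.linearMap t ∘ₗ mapRange.linearMap t := by
    refine lhom_ext fun p x => ?_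
    have htt : mapRange.linearMap t (mapRange.linearMap t (single p x)) =
        single p (f _ x.1, f _ x.2) := by
      rw [mapRange.linearMap_apply, mapRange.linearMap_apply, mapRange_single, mapRange_single, ht]
    rw [LinearMap.comp_apply, LinearMap.comp_apply, LinearMap.comp_apply, htt, hE, hE, map_add,
      mapRange.linearMap_apply, mapRange.linearMap_apply, mapRange_single, mapRange_single]
  refine LinearMap.ext fun w => ?_
  obtain ⟨v, rfl⟩ := e.surjective w
  rw [pow_two, Module.End.mul_apply, LinearEquiv.conj_apply_apply, LinearEquiv.conj_apply_apply,
    e.symm_apply_apply, e.symm_apply_apply]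
  exact LinearMap.congr_fun hcomp v

end DFinsupp

theorem ClassData.exists_shift_eq_sq (L : ClassData (ZMod 2)) (h : ∀ φ, L φ ∈ squarePartitions) :
    ∃ T : Module.End (ZMod 2) L.CanonModule, L.shift = T ^ 2 :=
  DFinsupp.exists_sq_eq_mapRange_of_pairs _ fun p =>
    AdjoinRoot.exists_sq_eq_prodMap_mulLeft_root p.1.2.2
      ((L p.1).rowLen_anti _ _ (Nat.le_succ _)) (rowLen_le_of_mem_squarePartitions (h p.1) p.2)

/-! ### Transfer to matrices -/

namespace ClassData

/-- Conjugation by the isomorphism `E` exchanges square roots of `A` and of `shift`. The criterion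
depends only on `L`, so one element decides for its whole class. -/
theorem mem_squareMatrices_iff {L : ClassData (ZMod 2)} {n : ℕ}
    {A : Matrix (Fin n) (Fin n) (ZMod 2)} (hA : A ∈ L.conjClass n) :
    A ∈ squareMatrices n ↔ ∀ φ, L φ ∈ squarePartitions := by
  obtain ⟨E, hE⟩ := L.exists_equiv_of_mem_conjClass hA
  constructor
  · rintro ⟨B, rfl⟩
    refine L.mem_squarePartitions_of_shift_eq_sq (T := E.conj B.vecMulLinear) ?_
    refine LinearMap.ext fun w => ?_
    obtain ⟨v, rfl⟩ := E.surjective w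
    rw [← hE, pow_two (E.conj _), Module.End.mul_apply, LinearEquiv.conj_apply_apply,
      LinearEquiv.conj_apply_apply, E.symm_apply_apply, E.symm_apply_apply,
      Matrix.vecMulLinear_apply, Matrix.vecMulLinear_apply, Matrix.vecMulLinear_apply,
      Matrix.vecMul_vecMul, pow_two]
  · intro h
    obtain ⟨T, hT⟩ := L.exists_shift_eq_sq h
    let B := LinearMap.toMatrixRight' (E.symm.conj T)
    have hB : ∀ v, Matrix.vecMul v B = E.symm (T (E v)) := fun v =>
      LinearMap.congr_fun (LinearMap.toMatrixRight'.symm_apply_apply (E.symm.conj T)) v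
    refine ⟨B, ?_⟩
    refine Matrix.ext_of_single_vecMul fun i => E.injective ?_
    refine (hE _).trans ?_
    rw [pow_two, ← Matrix.vecMul_vecMul, hB, hB, E.apply_symm_apply, E.apply_symm_apply, hT,
      pow_two, Module.End.mul_apply]

theorem dim_eq_of_mem_conjClass {F : Type*} [Field F] {L : ClassData F} {n : ℕ}
    {A : Matrix (Fin n) (Fin n) F} (hA : A ∈ L.conjClass n) : L.dim = n := by
  obtain ⟨e, -⟩ := hA
  rw [← L.card_repIndex, Nat.card_congr e, Nat.card_fin]

theorem conjClass_nonempty {F : Type*} [Field F] {L : ClassData F} {n : ℕ} (h : L.dim = n) :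
    (L.conjClass n).Nonempty :=
  ⟨_, Finite.equivFinOfCardEq (L.card_repIndex.trans h), IsConj.refl _⟩

end ClassData

theorem isUnionOfConjClasses_squareMatrices (n : ℕ) :
    IsUnionOfConjClasses (squareMatrices n) := by
  refine ⟨ConjClasses.mk '' squareMatrices n, ?_⟩
  ext A
  simp only [Set.mem_iUnion, Set.mem_image, exists_prop, exists_exists_and_eq_and,
    ConjClasses.mem_carrier_iff_mk_eq]
  constructor
  · exact fun h => ⟨A, h, rfl⟩
  · rintro ⟨_, ⟨B, rfl⟩, h⟩
    obtain ⟨c, hc⟩ := ConjClasses.mk_eq_mk_iff_isConj.1 h.symm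
    refine ⟨c * B * c⁻¹, ?_⟩
    rw [Units.conj_pow]
    exact (Units.eq_mul_inv_iff_mul_eq c).2 hc.eq.symm

end

theorem mainTheorem1 :
    (∀ n : ℕ, IsUnionOfConjClasses (squareMatrices n)) ∧
    IsPartitionUniform squareMatrices squarePartitions ∧
    ∀ (n : ℕ) (L : ClassData (ZMod 2)), L.dim = n →
      (L.conjClass n ⊆ squareMatrices n ↔ ∀ φ, L φ ∈ squarePartitions) := by
  refine ⟨isUnionOfConjClasses_squareMatrices, ⟨fun _ => bot_mem_squarePartitions,
    isUnionOfConjClasses_squareMatrices, fun n L => ⟨?_, ?_⟩⟩, fun n L hL => ⟨?_, ?_⟩⟩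
  · rintro ⟨A, hA, hAL⟩
    exact ⟨ClassData.dim_eq_of_mem_conjClass hAL, (ClassData.mem_squareMatrices_iff hAL).1 hA⟩
  · rintro ⟨hL, h⟩
    obtain ⟨A, hA⟩ := ClassData.conjClass_nonempty hL
    exact ⟨A, (ClassData.mem_squareMatrices_iff hA).2 h, hA⟩
  · intro h
    obtain ⟨A, hA⟩ := ClassData.conjClass_nonempty hL
    exact (ClassData.mem_squareMatrices_iff hA).1 (h hA)
  · exact fun h A hA => (ClassData.mem_squareMatrices_iff hA).2 h
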